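/- **Environment.** Let $I=\{1,2\}$, let $A_1,A_2$ be finite sets of actions, $A=A_1\times A_2$, and let $u_i:A\to\mathbb R$ be the payoff of player $i\in I$; $-i$ denotes the opponent of $i$. **FC-rationalizable actions.** For $A'=A'_1\times A'_2\subseteq A$, let $\Lambda_i(A')$ be the set of maps $\lambda_i:A_i\to\Delta(A_{-i})$ with $\lambda_i(A'_{-i}\mid a_i)=1$ for all $a_i\in A_i$. An action $a_i^*\in A_i$ is FC-rationalizable with respect to $A'$ if there are $\lambda_i^0\in\Delta(A_{-i})$, $\lambda_i^1\in\Lambda_i(A')$ and $\mu\in[0,1]$ such that $a_i^*$ maximizes $\sum_{a_{-i}}u_i(a_i,a_{-i})\lambda_i(a_{-i}\mid a_i)$ over $a_i\in A_i$, where $\lambda_i(\cdot\mid a_i)=\mu\lambda_i^0+(1-\mu)\lambda_i^1(\cdot\mid a_i)$. The set $A'$ is self-FC-rationalizable if each of its actions is FC-rationalizable with respect to $A'$. Let $A^{\mathrm{FR}}=A^{\mathrm{FR}}_1\times A^{\mathrm{FR}}_2$ be the largest self-FC-rationalizable set. **Interdependent-choice equilibrium (ICE).** Let $B=B_1\times B_2\subseteq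 A$, $\alpha\in\Delta(A)$ and $\theta:A\to\Delta(I)$, and put $B_i^*=B_i\cup\operatorname{supp}\alpha_i$, where $\alpha_i$ is the marginal of $\alpha$ on $A_i$. In the mediated game $(\alpha,\theta,B)$ a mediator privately draws $a^*$ from $\alpha$ and a first mover $i^*$ from $\theta(\cdot\mid a^*)$. She recommends $a^*_{i^*}$ to $i^*$ and observes the action $a^p_{i^*}$ that $i^*$ takes; then she recommends to $-i^*$ the action $a^*_{-i^*}$ if $a^p_{i^*}=a^*_{i^*}$, and an element of $\arg\min_{a_{-i^*}\in B^*_{-i^*}}u_{i^*}(a^p_{i^*},a_{-i^*})$ otherwise. A player knows only the recommendation received. The distribution $\alpha$ is an ICE with respect to $B$ if for some $\theta$ following the recommendations is a Nash equilibrium of this game; equivalently, if for some $\theta$, all $i\in I$ and all $a_i,a_i'\in A_i$, $$\sum_{a_{-i}\in A_{-i}}\alpha(a)\Big(u_i(a)-\big(1-\theta(i\mid a)\big)u_i(a_i',a_{-i})-\theta(i\mid a)\min_{b\in B^*_{-i}}u_i(a_i',b)\Big)\ge 0 ,\qquad a=(a_i,a_{-i}).$$ **Extensive form mechanisms.** Consider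 finite two-player extensive form games with perfect recall in which Nature may assign probability zero to available moves. A mechanism is such a game together with a map $\tau$ from terminal nodes onto $A$ such that each player's payoff at each terminal node $z$ is $u_i(\tau(z))$. At a decision node $y$ of player $i$, a move $m$ represents $a_i\in A_i$ if $\tau_i(z)=a_i$ for all terminal nodes $z$ after $(y,m)$, and $\tau_i(z)\ne a_i$ for some terminal node $z$ after some $(y,m')$, $m'$ a move available at $y$; the node $y$ is pivotal if every action of $i$ is represented by some move at $y$. It is required that the representation relation be the same at all nodes of an information set and that, for every terminal node $z$ and player $i$, the path to $z$ contain a pivotal node of $i$ at which $i$ makes a move representing $\tau_i(z)$. **Sequential implementation.** A sequential equilibrium is a pair $(\psi,\sigma)$ of a belief system and a (behavior) strategy profile such that (i) at every information set every move chosen with positive probability is optimal given $\psi$ and future choices according to $\sigma$ and Nature's probabilities; and (ii) $(\psi,\sigma)$, together with Nature's probabilities, is the limit of a single sequence (common to both players) of strictly mixed strategy profiles and strictly mixed probabilities for Nature, with the beliefs derived from them by Bayes' rule. A distribution $\alpha\in\Delta(A)$ is sequentially implementable if there are a mechanism and a sequential equilibrium of it for which the induced distribution of $\tau(z)$ is $\alpha$.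 **Claim.** Every sequentially implementable distribution $\alpha\in\Delta(A)$ is an interdependent-choice equilibrium with respect to $A^{\mathrm{FR}}$. -/

import Mathlib

open scoped BigOperators Topology

universe u v

noncomputable section

/-! ### Two-player environments

The two players are the elements of `Bool`; the opponent of `i` is `!i`.
Player `i` has the finite action set `A i`, and payoffs are `u : Bool → Profile A → ℝ`. -/

/-- Action profiles. -/
abbrev Profile (A : Bool → Type u) : Type u := ∀ i, A i

/-- The profile in which `i` plays `x` and the opponent of `i` plays `y`. -/
def Profile.pair {A : Bool → Type u} : (i : Bool) → A i → A (!i) → Profile A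
  | false, x, y => fun j => match j with
    | false => x
    | true => y
  | true, x, y => fun j => match j with
    | false => y
    | true => x

section Environment

variable {A : Bool → Type u} [∀ i, Fintype (A i)]

/-! ### Future-looking counterfactual rationalizability -/

/-- Expected utility of `i` from `x`, when `lam x' y` is the probability that `i` assigns to the
opponent playing `y` if `i` plays `x'`. -/
def counterfactualUtility (u : Bool → Profile A → ℝ) (i : Bool) (x : A i)
    (lam : A i → A (!i) → ℝ) : ℝ :=
  ∑ y, u i (Profile.pair i x y) * lam x y

/-- Counterfactual beliefs of `i`: a distribution over the opponent's actions for each own action,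
always giving probability one to the opponent's actions in `A'`. -/
def IsCounterfactualBelief (A' : ∀ j, Set (A j)) (i : Bool) (lam : A i → A (!i) → ℝ) : Prop :=
  ∀ x, lam x ∈ stdSimplex ℝ (A (!i)) ∧ ∀ y, y ∉ A' (!i) → lam x y = 0

/-- `fcr u A' i` is the set of actions of `i` which are FC-rationalizable with respect to `A'`. -/
def fcr (u : Bool → Profile A → ℝ) (A' : ∀ j, Set (A j)) : ∀ j, Set (A j) := fun i =>
  {x | ∃ lam0 ∈ stdSimplex ℝ (A (!i)), ∃ lam1, IsCounterfactualBelief A' i lam1 ∧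
    ∃ μ ∈ Set.Icc (0 : ℝ) 1, ∀ x' : A i,
      counterfactualUtility u i x' (fun z y => μ * lam0 y + (1 - μ) * lam1 z y) ≤
        counterfactualUtility u i x (fun z y => μ * lam0 y + (1 - μ) * lam1 z y)}

/-- `A'` is self-FC-rationalizable. -/
def SelfFCRationalizable (u : Bool → Profile A → ℝ) (A' : ∀ j, Set (A j)) : Prop :=
  ∀ i, A' i ⊆ fcr u A' i

/-- The FC-rationalizable actions: the union of all self-FC-rationalizable sets,
which is the largest such set by `isGreatest_fcRationalizable`. -/
def fcRationalizable (u : Bool → Profile A → ℝ) : ∀ j, Set (A j) := fun i =>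
  {x | ∃ A', SelfFCRationalizable u A' ∧ x ∈ A' i}

theorem isGreatest_fcRationalizable (u : Bool → Profile A → ℝ) :
    IsGreatest {A' : ∀ j, Set (A j) | SelfFCRationalizable u A'} (fcRationalizable u) := by
  constructor
  · rintro i x ⟨A', hA', hx⟩
    obtain ⟨lam0, h0, lam1, h1, μ, hμ, hbest⟩ := hA' i hx
    exact ⟨lam0, h0, lam1, fun z => ⟨(h1 z).1, fun y hy => (h1 z).2 y
      fun hy' => hy ⟨A', hA', hy'⟩⟩, μ, hμ, hbest⟩
  · intro A' hA' i x hx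
    exact ⟨A', hA', hx⟩

/-! ### Mediated mechanisms and interdependent-choice equilibrium -/

/-- Effective credible threats `B*_i = B_i ∪ supp α_i`. -/
def effectiveThreats (α : Profile A → ℝ) (B : ∀ j, Set (A j)) : ∀ j, Set (A j) := fun i =>
  B i ∪ {x | ∃ a : Profile A, a i = x ∧ 0 < α a}

/-- `pun i x`, recommended to the opponent of a first mover `i` who deviated to `x`, is one of the
worst punishments for `i` available in `Bs`. -/
def IsWorstPunishment (u : Bool → Profile A → ℝ) (Bs : ∀ j, Set (A j))
    (pun : ∀ i, A i → A (!i)) : Prop :=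
  ∀ i x, pun i x ∈ Bs (!i) ∧
    ∀ y ∈ Bs (!i), u i (Profile.pair i x (pun i x)) ≤ u i (Profile.pair i x y)

open Classical in
/-- The actions taken in the mediated game when the mediator intends `a`, player `j` moves first,
and each player `i` reacts to the recommendation `r` by playing `s i r`: the first mover is
recommended the intended action, and the second mover is recommended the intended action if the
first one complied and a punishment otherwise. -/
def mediatedPlay (pun : ∀ i, A i → A (!i)) (s : ∀ i, A i → A i) (a : Profile A) (j : Bool) :
    Profile A :=
  Profile.pair j (s j (a j))
    (s (!j) (if s j (a j) = a j then a (!j) else pun j (s j (a j))))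

/-- Expected payoff of `i` in the mediated game; `θ a j` is the probability that `j` moves first
when the mediator intends `a`. -/
def mediatedPayoff (u : Bool → Profile A → ℝ) (α : Profile A → ℝ) (θ : Profile A → Bool → ℝ)
    (pun : ∀ i, A i → A (!i)) (s : ∀ i, A i → A i) (i : Bool) : ℝ :=
  ∑ a, ∑ j, α a * θ a j * u i (mediatedPlay pun s a j)

/-- The mediated mechanism `(α, θ, B)` is incentive compatible: following the recommendations is
a Nash equilibrium of the mediated game. A player knows only the recommendation received, and
by linearity it is enough to consider pure deviations. -/
def IncentiveCompatible (u : Bool → Profile A → ℝ) (α : Profile A → ℝ)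
    (θ : Profile A → Bool → ℝ) (B : ∀ j, Set (A j)) : Prop :=
  ∃ pun, IsWorstPunishment u (effectiveThreats α B) pun ∧
    ∀ (i : Bool) (s' : A i → A i),
      mediatedPayoff u α θ pun (Function.update (fun _ => id) i s') i ≤
        mediatedPayoff u α θ pun (fun _ => id) i

/-- `α` is an interdependent-choice equilibrium with respect to the credible threats `B`. -/
def IsICE (u : Bool → Profile A → ℝ) (B : ∀ j, Set (A j)) (α : Profile A → ℝ) : Prop :=
  α ∈ stdSimplex ℝ (Profile A) ∧
    ∃ θ : Profile A → Bool → ℝ, (∀ a, θ a ∈ stdSimplex ℝ Bool) ∧ IncentiveCompatible u α θ B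

end Environment

/-! ### Finite extensive form games with perfect recall -/

/-- The experience of player `i` along the moves `t` made from the node `x` on: the information
sets (with labels in `H`) at which `i` moves, with the moves made there, in order. -/
def experienceFrom {M H : Type v} (mover : List M → Option Bool) (info : List M → H) (i : Bool) :
    List M → List M → List (H × M)
  | _, [] => []
  | x, m :: t =>
    if mover x = some i then (info x, m) :: experienceFrom mover info i (x ++ [m]) t
    else experienceFrom mover info i (x ++ [m]) t

/-- Finite two-player extensive form games with perfect recall. Nodes are finite sequences of
moves, and `mover x = none` means that Nature moves at `x`. The information sets of player `i` are
the sets of decision nodes of `i` with a common label `info x`. Nature may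
assign probability zero to available moves. -/
structure ExtensiveGame (M H : Type v) where
  nodes : Finset (List M)
  root_mem : [] ∈ nodes
  prefix_mem : ∀ x m, x ++ [m] ∈ nodes → x ∈ nodes
  mover : List M → Option Bool
  info : List M → H
  chance : List M → M → ℝ
  payoff : Bool → List M → ℝ
  /-- the same moves are available at all nodes of an information set -/
  avail_eq : ∀ x ∈ nodes, ∀ y ∈ nodes, (∃ m, x ++ [m] ∈ nodes) → (∃ m, y ++ [m] ∈ nodes) →
    ∀ i, mover x = some i → mover y = some i → info x = info y →
      ∀ m, x ++ [m] ∈ nodes ↔ y ++ [m] ∈ nodes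
  /-- perfect recall -/
  perfect_recall : ∀ x ∈ nodes, ∀ y ∈ nodes,
    (∃ m, x ++ [m] ∈ nodes) → (∃ m, y ++ [m] ∈ nodes) →
    ∀ i, mover x = some i → mover y = some i → info x = info y →
      experienceFrom mover info i [] x = experienceFrom mover info i [] y
  chance_nonneg : ∀ x m, mover x = none → x ++ [m] ∈ nodes → 0 ≤ chance x m
  chance_sum : ∀ x ∈ nodes, mover x = none → (∃ m, x ++ [m] ∈ nodes) →
    ∑ᶠ m ∈ {m | x ++ [m] ∈ nodes}, chance x m = 1

namespace ExtensiveGame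

variable {M H : Type v} (G : ExtensiveGame M H)

/-- The set of moves available at `x`. -/
def avail (x : List M) : Set M := {m | x ++ [m] ∈ G.nodes}

open Classical in
/-- Terminal nodes. -/
def terminal : Finset (List M) := G.nodes.filter fun x => ∀ m, m ∉ G.avail x

open Classical in
/-- Terminal nodes that can be reached after `x`. -/
def terminalAfter (x : List M) : Finset (List M) := G.terminal.filter fun z => x <+: z

open Classical in
/-- Decision nodes of player `i`. -/
def decision (i : Bool) : Finset (List M) :=
  G.nodes.filter fun x => (∃ m, m ∈ G.avail x) ∧ G.mover x = some i

open Classical in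
/-- The information set of player `i` with label `h`. -/
def infoSet (i : Bool) (h : H) : Finset (List M) := (G.decision i).filter fun x => G.info x = h

/-- Behavior strategy profiles; `σ i h m` is the probability of the move `m` at the information
set of `i` with label `h`. -/
def IsStrategy (σ : Bool → H → M → ℝ) : Prop :=
  ∀ i, ∀ y ∈ G.decision i,
    (∀ m ∈ G.avail y, 0 ≤ σ i (G.info y) m) ∧ ∑ᶠ m ∈ G.avail y, σ i (G.info y) m = 1

/-- Every available move has positive probability. -/
def IsStrictlyMixed (σ : Bool → H → M → ℝ) : Prop :=
  ∀ i, ∀ y ∈ G.decision i, ∀ m ∈ G.avail y, 0 < σ i (G.info y) m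

/-- Strictly mixed strategies (or beliefs about the choices) of Nature. -/
def IsStrictlyMixedChance (χ : List M → M → ℝ) : Prop :=
  ∀ x ∈ G.nodes, G.mover x = none → (∃ m, m ∈ G.avail x) →
    (∀ m ∈ G.avail x, 0 < χ x m) ∧ ∑ᶠ m ∈ G.avail x, χ x m = 1

/-- Belief systems: a distribution over the nodes of each information set. -/
def IsBeliefSystem (ψ : Bool → H → List M → ℝ) : Prop :=
  ∀ i, ∀ y ∈ G.decision i,
    (∀ x ∈ G.infoSet i (G.info y), 0 ≤ ψ i (G.info y) x) ∧
      ∑ x ∈ G.infoSet i (G.info y), ψ i (G.info y) x = 1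

/-- Probability of the move `m` at `x`. -/
def moveProb (σ : Bool → H → M → ℝ) (χ : List M → M → ℝ) (x : List M) (m : M) : ℝ :=
  match G.mover x with
  | none => χ x m
  | some i => σ i (G.info x) m

/-- Probability that play follows the moves `t` after having reached the node `x`. -/
def pathProb (σ : Bool → H → M → ℝ) (χ : List M → M → ℝ) : List M → List M → ℝ
  | _, [] => 1
  | x, m :: t => G.moveProb σ χ x m * pathProb σ χ (x ++ [m]) t

/-- Probability of reaching the node `x`. -/
def reachProb (σ : Bool → H → M → ℝ) (χ : List M → M → ℝ) (x : List M) : ℝ :=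
  G.pathProb σ χ [] x

/-- Expected payoff of `i` once play has reached the node `x`. -/
def continuationPayoff (σ : Bool → H → M → ℝ) (χ : List M → M → ℝ) (i : Bool) (x : List M) : ℝ :=
  ∑ z ∈ G.terminalAfter x, G.pathProb σ χ x (z.drop x.length) * G.payoff i z

/-- Expected payoff of `i` from choosing `m` at the information set with label `h`, given the
interim beliefs `ψ` and future choices according to `σ` (and to Nature's probabilities). -/
def interimPayoff (ψ : Bool → H → List M → ℝ) (σ : Bool → H → M → ℝ) (i : Bool) (h : H) (m : M) :
    ℝ :=
  ∑ y ∈ G.infoSet i h, ψ i h y * G.continuationPayoff σ G.chance i (y ++ [m])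

/-- Sequential rationality: at every information set, every move chosen with positive probability
is optimal. -/
def SequentiallyRational (ψ : Bool → H → List M → ℝ) (σ : Bool → H → M → ℝ) : Prop :=
  ∀ i, ∀ y ∈ G.decision i, ∀ m ∈ G.avail y, ∀ m' ∈ G.avail y, 0 < σ i (G.info y) m →
    G.interimPayoff ψ σ i (G.info y) m' ≤ G.interimPayoff ψ σ i (G.info y) m

/-- Bayes' rule (for strictly mixed strategies and beliefs about Nature). -/
def SatisfiesBayes (ψ : Bool → H → List M → ℝ) (σ : Bool → H → M → ℝ) (χ : List M → M → ℝ) :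
    Prop :=
  ∀ i, ∀ y ∈ G.decision i,
    ψ i (G.info y) y =
      G.reachProb σ χ y / ∑ x ∈ G.infoSet i (G.info y), G.reachProb σ χ x

/-- Consistency: the assessment is the limit of strictly mixed assessments satisfying Bayes' rule,
one sequence for both players. Trembles of Nature are allowed. -/
def Consistent (ψ : Bool → H → List M → ℝ) (σ : Bool → H → M → ℝ) : Prop :=
  ∃ (ψs : ℕ → Bool → H → List M → ℝ) (σs : ℕ → Bool → H → M → ℝ) (χs : ℕ → List M → M → ℝ),
    (∀ n, G.IsStrategy (σs n) ∧ G.IsStrictlyMixed (σs n) ∧ G.IsStrictlyMixedChance (χs n) ∧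
      G.IsBeliefSystem (ψs n) ∧ G.SatisfiesBayes (ψs n) (σs n) (χs n)) ∧
    (∀ i, ∀ y ∈ G.decision i,
      Filter.Tendsto (fun n => ψs n i (G.info y) y) Filter.atTop (𝓝 (ψ i (G.info y) y))) ∧
    (∀ i, ∀ y ∈ G.decision i, ∀ m ∈ G.avail y,
      Filter.Tendsto (fun n => σs n i (G.info y) m) Filter.atTop (𝓝 (σ i (G.info y) m))) ∧
    (∀ x ∈ G.nodes, G.mover x = none → ∀ m ∈ G.avail x,
      Filter.Tendsto (fun n => χs n x m) Filter.atTop (𝓝 (G.chance x m)))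

/-- Sequential equilibrium. -/
def IsSequentialEquilibrium (ψ : Bool → H → List M → ℝ) (σ : Bool → H → M → ℝ) : Prop :=
  G.IsBeliefSystem ψ ∧ G.IsStrategy σ ∧ G.Consistent ψ σ ∧ G.SequentiallyRational ψ σ

/-! ### Extensive form mechanisms -/

variable {A : Bool → Type u}

/-- `τ` maps terminal nodes onto action profiles and preserves preferences. -/
def IsOutcomeHom (u : Bool → Profile A → ℝ) (τ : List M → Profile A) : Prop :=
  (∀ a, ∃ z ∈ G.terminal, τ z = a) ∧ ∀ z ∈ G.terminal, ∀ i, G.payoff i z = u i (τ z)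

/-- The move `m` represents the action `b` of player `i` at the decision node `y` of `i`. -/
def Represents (τ : List M → Profile A) (i : Bool) (y : List M) (m : M) (b : A i) : Prop :=
  y ∈ G.decision i ∧ m ∈ G.avail y ∧
    (∀ z ∈ G.terminalAfter (y ++ [m]), τ z i = b) ∧
    ∃ m' ∈ G.avail y, ∃ z ∈ G.terminalAfter (y ++ [m']), τ z i ≠ b

/-- At the decision node `y` of `i`, every action of `i` is represented by some move. -/
def IsPivotal (τ : List M → Profile A) (i : Bool) (y : List M) : Prop :=
  y ∈ G.decision i ∧ ∀ b : A i, ∃ m, G.Represents τ i y m b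

/-- Full disclosure of consequences. -/
def FullDisclosure (τ : List M → Profile A) : Prop :=
  ∀ i, ∀ y ∈ G.decision i, ∀ y' ∈ G.decision i, G.info y = G.info y' →
    ∀ (m : M) (b : A i), G.Represents τ i y m b ↔ G.Represents τ i y' m b

/-- `(G, τ)` is an extensive form mechanism for the environment with payoffs `u`. -/
def IsMechanism (u : Bool → Profile A → ℝ) (τ : List M → Profile A) : Prop :=
  G.IsOutcomeHom u τ ∧ G.FullDisclosure τ ∧
    ∀ z ∈ G.terminal, ∀ i, ∃ y m, G.IsPivotal τ i y ∧ G.Represents τ i y m (τ z i) ∧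
      z ∈ G.terminalAfter (y ++ [m])

open Classical in
/-- The distribution over action profiles induced by a strategy profile. -/
def inducedDist (τ : List M → Profile A) (σ : Bool → H → M → ℝ) (a : Profile A) : ℝ :=
  ∑ z ∈ G.terminal.filter (fun z => τ z = a), G.reachProb σ G.chance z

end ExtensiveGame

/-- `α` is induced by a sequential equilibrium of an extensive form mechanism. -/
def SequentiallyImplementable {A : Bool → Type u} [∀ i, Fintype (A i)]
    (u : Bool → Profile A → ℝ) (α : Profile A → ℝ) : Prop :=
  α ∈ stdSimplex ℝ (Profile A) ∧
    ∃ (M H : Type v) (G : ExtensiveGame M H) (τ : List M → Profile A)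
      (ψ : Bool → H → List M → ℝ) (σ : Bool → H → M → ℝ),
      G.IsMechanism u τ ∧ G.IsSequentialEquilibrium ψ σ ∧ ∀ a, α a = G.inducedDist τ σ a

end

/-! Call a move a commitment of `i` when it is made at a pivotal node of `i` and represents an
action. On each path to a terminal node each player commits exactly once, and the two commitments
occur at different depths, so exactly one player commits first. The mediated mechanism replaces the
game by this order: `θ a i` is the conditional probability that `i` commits first given the outcome
`a`.

Credible threats. At a pivotal information set, reached or not, split the nodes by whether the
opponent has already committed. Where she has, her action does not depend on the move of `i`: this
gives the constant part `λ⁰`, with weight `μ` equal to the belief in these nodes. Where she has not,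
she will only take actions that are committed to with positive probability somewhere: this gives
`λ¹`. Hence the set `committedActions` is self-FC-rationalizable
(`selfFCRationalizable_committedActions`) and lies in `fcRationalizable u`.

Incentives. Weight the optimality of committing to `b` rather than `b'` by reach probabilities and
sum over information sets (`sum_terminal_nonneg`). After a deviation, an opponent who has committed
keeps her action, and one who has not reacts within `committedActions`, so at best as harshly as the
mediator's worst punishment (`reachProb_mul_le`). The resulting inequalities imply the ICE
constraints. -/

namespace Profile

variable {A : Bool → Type u}

@[simp] theorem pair_eta (i : Bool) (a : Profile A) : pair i (a i) (a (!i)) = a := by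
  cases i <;> (funext j; cases j <;> rfl)

end Profile

/-! ### Unilateral deviations in the mediated game -/

open Classical in
theorem mediatedPlay_update_self {A : Bool → Type u} (pun : ∀ i, A i → A (!i)) (i : Bool)
    (s : A i → A i) (a : Profile A) :
    mediatedPlay pun (Function.update (fun _ => id) i s) a i =
      Profile.pair i (s (a i)) (if s (a i) = a i then a (!i) else pun i (s (a i))) := by
  cases i <;> simp [mediatedPlay]

theorem mediatedPlay_update_opponent {A : Bool → Type u} (pun : ∀ i, A i → A (!i)) (i : Bool)
    (s : A i → A i) (a : Profile A) :
    mediatedPlay pun (Function.update (fun _ => id) i s) a (!i) =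
      Profile.pair i (s (a i)) (a (!i)) := by
  cases i <;> funext j <;> cases j
  exacts [congrArg s (if_pos rfl), rfl, rfl, congrArg s (if_pos rfl)]

theorem mediatedPlay_id {A : Bool → Type u} (pun : ∀ i, A i → A (!i)) (j : Bool)
    (a : Profile A) : mediatedPlay pun (fun _ => id) a j = a := by
  simp [mediatedPlay]

/-- A nonnegative weight carried by a nonempty set is a multiple of a distribution carried by
that set. -/
theorem exists_mem_stdSimplex_mul_eq {ι : Type*} [Fintype ι] (S : Set ι) (hS : S.Nonempty)
    (w : ι → ℝ) (hw : ∀ y, 0 ≤ w y) (hwS : ∀ y, y ∉ S → w y = 0) :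
    ∃ p ∈ stdSimplex ℝ ι, (∀ y, y ∉ S → p y = 0) ∧ ∀ y, (∑ y', w y') * p y = w y := by
  classical
  -- If the total vanishes then so does `w`, and any distribution on `S` will do; a point mass is
  -- used.
  by_cases h : ∑ y', w y' = 0
  · obtain ⟨y₀, hy₀⟩ := hS
    refine ⟨Pi.single y₀ 1, single_mem_stdSimplex ℝ y₀, fun y hy => ?_, fun y => ?_⟩
    · exact Pi.single_eq_of_ne (by rintro rfl; exact hy hy₀) _
    · rw [h, zero_mul, (Finset.sum_eq_zero_iff_of_nonneg fun y _ => hw y).1 h y (Finset.mem_univ y)]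
  · refine ⟨fun y => w y / ∑ y', w y', ⟨fun y => div_nonneg (hw y)
      (Finset.sum_nonneg fun y _ => hw y), ?_⟩, fun y hy => by simp [hwS y hy],
      fun y => mul_div_cancel₀ _ h⟩
    rw [← Finset.sum_div, div_self h]

namespace ExtensiveGame

/-! ### Prefixes and terminal nodes -/

section Tree

variable {M H : Type v} (G : ExtensiveGame M H)

theorem mem_nodes_of_prefix {x z : List M} (h : x <+: z) (hz : z ∈ G.nodes) : x ∈ G.nodes := by
  obtain ⟨t, rfl⟩ := h
  induction t using List.reverseRecOn with
  | nil => simpa using hz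
  | append_singleton t m ih => exact ih (G.prefix_mem _ m (by simpa using hz))

theorem exists_avail_of_prefix_of_ne {x z : List M} (h : x <+: z) (hz : z ∈ G.nodes)
    (hne : x ≠ z) : ∃ m ∈ G.avail x, x ++ [m] <+: z := by
  obtain ⟨t, rfl⟩ := h
  cases t with
  | nil => simp at hne
  | cons m t =>
    have h' : x ++ [m] <+: x ++ m :: t := ⟨t, by simp⟩
    exact ⟨m, G.mem_nodes_of_prefix h' hz, h'⟩

theorem avail_finite (x : List M) : (G.avail x).Finite :=
  G.nodes.finite_toSet.preimage (f := fun m => x ++ [m]) fun m _ m' _ h => by simpa using h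

theorem mem_terminal {z : List M} : z ∈ G.terminal ↔ z ∈ G.nodes ∧ ∀ m, m ∉ G.avail z := by
  simp [terminal]

theorem mem_terminalAfter {x z : List M} :
    z ∈ G.terminalAfter x ↔ z ∈ G.terminal ∧ x <+: z := by
  simp [terminalAfter]

theorem mem_decision {i : Bool} {x : List M} :
    x ∈ G.decision i ↔ x ∈ G.nodes ∧ (∃ m, m ∈ G.avail x) ∧ G.mover x = some i := by
  simp [decision]

theorem mem_infoSet {i : Bool} {h : H} {x : List M} :
    x ∈ G.infoSet i h ↔ x ∈ G.decision i ∧ G.info x = h := by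
  simp [infoSet]

theorem terminalAfter_nonempty {x : List M} (hx : x ∈ G.nodes) : (G.terminalAfter x).Nonempty := by
  classical
  obtain ⟨z, hz, hmax⟩ := (G.nodes.filter fun z => x <+: z).exists_max_image List.length
    ⟨x, by simp [hx]⟩
  rw [Finset.mem_filter] at hz
  refine ⟨z, G.mem_terminalAfter.2 ⟨G.mem_terminal.2 ⟨hz.1, fun m hm => ?_⟩, hz.2⟩⟩
  have := hmax (z ++ [m]) (Finset.mem_filter.2 ⟨hm, hz.2.trans (List.prefix_append _ _)⟩)
  simp at this

theorem terminalAfter_of_terminal {x : List M} (hx : x ∈ G.terminal) :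
    G.terminalAfter x = {x} := by
  ext z
  rw [mem_terminalAfter, Finset.mem_singleton]
  refine ⟨fun ⟨hz, hxz⟩ => ?_, by rintro rfl; exact ⟨hx, List.prefix_rfl⟩⟩
  by_contra hne
  obtain ⟨m, hm, -⟩ := G.exists_avail_of_prefix_of_ne hxz (G.mem_terminal.1 hz).1 (Ne.symm hne)
  exact (G.mem_terminal.1 hx).2 m hm

open Classical in
theorem terminalAfter_eq_biUnion {x : List M} (hx : x ∉ G.terminal) :
    G.terminalAfter x =
      (G.avail_finite x).toFinset.biUnion fun m => G.terminalAfter (x ++ [m]) := by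
  ext z
  simp only [mem_terminalAfter, Finset.mem_biUnion, Set.Finite.mem_toFinset]
  constructor
  · rintro ⟨hz, hxz⟩
    obtain ⟨m, hm, h⟩ := G.exists_avail_of_prefix_of_ne hxz (G.mem_terminal.1 hz).1
      (fun h => hx (h ▸ hz))
    exact ⟨m, hm, hz, h⟩
  · rintro ⟨m, -, hz, h⟩
    exact ⟨hz, (List.prefix_append _ _).trans h⟩

theorem prefix_snoc_inj {x y z : List M} {m n : M} (hx : x ++ [m] <+: z) (hy : y ++ [n] <+: z)
    (h : x.length = y.length) : x = y ∧ m = n := by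
  have := List.prefix_of_prefix_length_le hx hy (by simp [h])
  have := this.eq_of_length (by simp [h])
  simpa using this

theorem snoc_prefix_of_length_lt {x y z : List M} {m : M} (hx : x ++ [m] <+: z) (hy : y <+: z)
    (h : x.length < y.length) : x ++ [m] <+: y :=
  List.prefix_of_prefix_length_le hx hy (by simpa using h)

end Tree

/-! ### Path probabilities and Bayes' rule -/

section Probability

variable {M H : Type v} (G : ExtensiveGame M H) {σ : Bool → H → M → ℝ} {χ : List M → M → ℝ}

theorem pathProb_append (x s t : List M) :
    G.pathProb σ χ x (s ++ t) = G.pathProb σ χ x s * G.pathProb σ χ (x ++ s) t := by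
  induction s generalizing x with
  | nil => simp [pathProb]
  | cons m s ih => simp [pathProb, ih, mul_assoc]

theorem moveProb_nonneg (hσ : G.IsStrategy σ) {x : List M} {m : M} (hm : m ∈ G.avail x) :
    0 ≤ G.moveProb σ G.chance x m := by
  have hx : x ∈ G.nodes := G.prefix_mem x m hm
  unfold moveProb
  split
  · exact G.chance_nonneg x m ‹_› hm
  · exact (hσ _ x (G.mem_decision.2 ⟨hx, ⟨m, hm⟩, ‹_›⟩)).1 m hm

theorem moveProb_of_mem_decision {i : Bool} {x : List M} (hx : x ∈ G.decision i) (m : M) :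
    G.moveProb σ χ x m = σ i (G.info x) m := by
  simp [moveProb, (G.mem_decision.1 hx).2.2]

theorem sum_moveProb (hσ : G.IsStrategy σ) {x : List M} (hx : x ∈ G.nodes)
    (hx' : ∃ m, m ∈ G.avail x) :
    ∑ m ∈ (G.avail_finite x).toFinset, G.moveProb σ G.chance x m = 1 := by
  rw [← finsum_mem_eq_finite_toFinset_sum]
  unfold moveProb
  split
  · exact G.chance_sum x hx ‹_› hx'
  · exact (hσ _ x (G.mem_decision.2 ⟨hx, hx', ‹_›⟩)).2

theorem pathProb_nonneg (hσ : G.IsStrategy σ) (x t : List M) (h : x ++ t ∈ G.nodes) :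
    0 ≤ G.pathProb σ G.chance x t := by
  induction t generalizing x with
  | nil => simp [pathProb]
  | cons m t ih =>
    have h' : x ++ [m] ++ t ∈ G.nodes := by simpa using h
    exact mul_nonneg (G.moveProb_nonneg hσ (G.mem_nodes_of_prefix (List.prefix_append _ _) h'))
      (ih _ h')

theorem pathProb_drop_nonneg (hσ : G.IsStrategy σ) {x z : List M} (hz : z ∈ G.terminalAfter x) :
    0 ≤ G.pathProb σ G.chance x (z.drop x.length) := by
  rw [mem_terminalAfter] at hz
  obtain ⟨t, rfl⟩ := hz.2
  simpa using G.pathProb_nonneg hσ x t (G.mem_terminal.1 hz.1).1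

theorem reachProb_nonneg (hσ : G.IsStrategy σ) {x : List M} (hx : x ∈ G.nodes) :
    0 ≤ G.reachProb σ G.chance x :=
  G.pathProb_nonneg hσ [] x hx

theorem reachProb_eq_mul {x z : List M} {m : M} (h : x ++ [m] <+: z) :
    G.reachProb σ χ z = G.reachProb σ χ x * G.moveProb σ χ x m *
      G.pathProb σ χ (x ++ [m]) (z.drop (x ++ [m]).length) := by
  obtain ⟨t, rfl⟩ := h
  simp only [reachProb, List.drop_left]
  rw [pathProb_append, pathProb_append]
  simp [pathProb]

theorem moveProb_ne_zero_of_pathProb_ne_zero {x y z : List M} {m : M} (hxy : x <+: y)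
    (hyz : y ++ [m] <+: z) (h : G.pathProb σ χ x (z.drop x.length) ≠ 0) :
    G.moveProb σ χ y m ≠ 0 := by
  obtain ⟨s, rfl⟩ := hxy
  obtain ⟨t, rfl⟩ := hyz
  rw [show x ++ s ++ [m] ++ t = x ++ (s ++ m :: t) by simp, List.drop_left, pathProb_append] at h
  exact left_ne_zero_of_mul (right_ne_zero_of_mul h)

theorem sum_pathProb_terminalAfter (hσ : G.IsStrategy σ) {x : List M} (hx : x ∈ G.nodes) :
    ∑ z ∈ G.terminalAfter x, G.pathProb σ G.chance x (z.drop x.length) = 1 := by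
  classical
  -- Induction on a bound `k` for the remaining depth; for `k = 0` the node would be longer than
  -- every node.
  suffices H : ∀ k x, x ∈ G.nodes → G.nodes.sup List.length < x.length + k →
      ∑ z ∈ G.terminalAfter x, G.pathProb σ G.chance x (z.drop x.length) = 1 from
    H (G.nodes.sup List.length + 1) x hx (by omega)
  clear hx x
  intro k
  induction k with
  | zero =>
    intro x hx h
    have := Finset.le_sup (f := List.length) hx
    omega
  | succ k ih =>
    intro x hx h
    by_cases hxt : x ∈ G.terminal
    · simp [G.terminalAfter_of_terminal hxt, pathProb]
    · have hav : ∃ m, m ∈ G.avail x := by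
        by_contra hno
        exact hxt (G.mem_terminal.2 ⟨hx, not_exists.1 hno⟩)
      rw [G.terminalAfter_eq_biUnion hxt, Finset.sum_biUnion, ← G.sum_moveProb hσ hx hav]
      · refine Finset.sum_congr rfl fun m hm => ?_
        have hm' : x ++ [m] ∈ G.nodes := (G.avail_finite x).mem_toFinset.1 hm
        rw [← mul_one (G.moveProb _ _ _ _), ← ih (x ++ [m]) hm'
          (by rw [List.length_append, List.length_singleton]; omega), Finset.mul_sum]
        refine Finset.sum_congr rfl fun z hz => ?_
        obtain ⟨t, rfl⟩ := (G.mem_terminalAfter.1 hz).2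
        rw [List.drop_left, List.append_assoc, List.drop_left]
        rfl
      · intro m _ m' _ hne
        refine Finset.disjoint_left.2 fun z hz hz' => hne ?_
        exact (prefix_snoc_inj (G.mem_terminalAfter.1 hz).2 (G.mem_terminalAfter.1 hz').2 rfl).2

theorem sum_reachProb_terminal (hσ : G.IsStrategy σ) :
    ∑ z ∈ G.terminal, G.reachProb σ G.chance z = 1 := by
  rw [← G.sum_pathProb_terminalAfter hσ G.root_mem]
  refine Finset.sum_congr ?_ fun z _ => by simp [reachProb]
  ext z
  simp [mem_terminalAfter]

/-- In a consistent assessment, beliefs agree with Bayes' rule at information sets reached with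
positive probability. -/
theorem Consistent.belief_mul_sum {G : ExtensiveGame M H} {ψ : Bool → H → List M → ℝ}
    (h : G.Consistent ψ σ) {i : Bool} {y : List M} (hy : y ∈ G.decision i) :
    ψ i (G.info y) y * ∑ x ∈ G.infoSet i (G.info y), G.reachProb σ G.chance x =
      G.reachProb σ G.chance y := by
  obtain ⟨ψs, σs, χs, hs, hψ, hσ, hχ⟩ := h
  have hmove : ∀ x m, m ∈ G.avail x → Filter.Tendsto (fun n => G.moveProb (σs n) (χs n) x m)
      Filter.atTop (𝓝 (G.moveProb σ G.chance x m)) := by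
    intro x m hm
    have hx : x ∈ G.nodes := G.prefix_mem x m hm
    unfold moveProb
    split
    · exact hχ x hx ‹_› m hm
    · exact hσ _ x (G.mem_decision.2 ⟨hx, ⟨m, hm⟩, ‹_›⟩) m hm
  have hpath : ∀ t x, x ++ t ∈ G.nodes → Filter.Tendsto
      (fun n => G.pathProb (σs n) (χs n) x t) Filter.atTop (𝓝 (G.pathProb σ G.chance x t)) := by
    intro t
    induction t with
    | nil => intro x _; exact tendsto_const_nhds
    | cons m t ih =>
      intro x hx
      have hx' : x ++ [m] ++ t ∈ G.nodes := by simpa using hx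
      exact (hmove x m (G.mem_nodes_of_prefix (List.prefix_append _ _) hx')).mul (ih _ hx')
  have hreach : ∀ x ∈ G.nodes, Filter.Tendsto
      (fun n => G.reachProb (σs n) (χs n) x) Filter.atTop (𝓝 (G.reachProb σ G.chance x)) :=
    fun x hx => hpath x [] hx
  -- The product form of Bayes' rule passes to the limit even where the reach probabilities tend to
  -- zero.
  refine tendsto_nhds_unique ((hψ i y hy).mul (tendsto_finsetSum (G.infoSet i (G.info y))
    fun x hx => hreach x (G.mem_decision.1 (G.mem_infoSet.1 hx).1).1)) ?_
  refine (hreach y (G.mem_decision.1 hy).1).congr fun n => ?_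
  obtain ⟨-, -, -, hbel, hbayes⟩ := hs n
  rw [hbayes i y hy]
  -- The denominator is nonzero: otherwise division by zero would make all beliefs in the
  -- information set `0`, while they sum to `1`.
  refine (div_mul_cancel₀ _ fun h0 => ?_).symm
  have h1 := (hbel i y hy).2
  rw [Finset.sum_eq_zero] at h1
  · exact zero_ne_one h1
  · intro x hx
    obtain ⟨hx, hxy⟩ := G.mem_infoSet.1 hx
    have := hbayes i x hx
    rw [hxy, h0, div_zero] at this
    exact this

end Probability

/-! ### Commitment at pivotal nodes -/

section Commitment

variable {M H : Type v} (G : ExtensiveGame M H) {A : Bool → Type u}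

/-- At the pivotal node `y` of `i`, the move `m` represents the action `b`. -/
def Commits (τ : List M → Profile A) (i : Bool) (y : List M) (m : M) (b : A i) : Prop :=
  G.IsPivotal τ i y ∧ G.Represents τ i y m b

/-- Player `i` has committed to the action `b` before reaching `x`. -/
def HasCommitted (τ : List M → Profile A) (i : Bool) (x : List M) (b : A i) : Prop :=
  ∃ y m, G.Commits τ i y m b ∧ y ++ [m] <+: x

/-- On the path to `z`, player `i` commits before the opponent does. -/
def CommitsFirst (τ : List M → Profile A) (i : Bool) (z : List M) : Prop :=
  ∃ y m, G.Commits τ i y m (τ z i) ∧ y ++ [m] <+: z ∧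
    ∀ j, j ≠ i → ∀ c, ¬ G.HasCommitted τ j y c

/-- Actions to which `i` commits with positive probability at some information set. -/
def committedActions (τ : List M → Profile A) (σ : Bool → H → M → ℝ) : ∀ i, Set (A i) := fun i =>
  {b | ∃ y m, G.Commits τ i y m b ∧ 0 < σ i (G.info y) m}

variable {G} {τ : List M → Profile A} {i j : Bool} {x y z : List M} {m n : M} {b : A i} {c : A j}

theorem Commits.outcome (h : G.Commits τ i y m b) (hz : z ∈ G.terminal) (hyz : y ++ [m] <+: z) :
    τ z i = b :=
  h.2.2.2.1 z (G.mem_terminalAfter.2 ⟨hz, hyz⟩)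

theorem HasCommitted.outcome (h : G.HasCommitted τ i x b) (hz : z ∈ G.terminal) (hxz : x <+: z) :
    τ z i = b :=
  let ⟨_, _, hc, hyx⟩ := h
  hc.outcome hz (hyx.trans hxz)

/-- Representation at `y` requires an action of `i` other than `b` to be possible. A pivotal node
`x` after the commitment would represent that action too, although every outcome there has `b`. -/
theorem Commits.not_prefix {b' : A i} (h : G.Commits τ i y m b) (h' : G.Commits τ i x n b') :
    ¬ y ++ [m] <+: x := by
  intro hyx
  obtain ⟨-, -, -, m', -, z, -, hne⟩ := h.2
  obtain ⟨n', hn'⟩ := h'.1.2 (τ z i)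
  obtain ⟨w, hw⟩ := G.terminalAfter_nonempty hn'.2.1
  have hw' := G.mem_terminalAfter.1 hw
  exact hne ((hn'.2.2.1 w hw).symm.trans
    (h.outcome hw'.1 (hyx.trans ((List.prefix_append _ _).trans hw'.2))))

theorem Commits.unique {b' : A i} (h : G.Commits τ i y m b) (h' : G.Commits τ i x n b')
    (hy : y ++ [m] <+: z) (hx : x ++ [n] <+: z) : y = x ∧ m = n := by
  rcases lt_trichotomy y.length x.length with hlt | heq | hlt
  · exact absurd (snoc_prefix_of_length_lt hy ((List.prefix_append _ _).trans hx) hlt)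
      (h.not_prefix h')
  · exact prefix_snoc_inj hy hx heq
  · exact absurd (snoc_prefix_of_length_lt hx ((List.prefix_append _ _).trans hy) hlt)
      (h'.not_prefix h)

theorem length_ne_of_mem_decision (hy : y ∈ G.decision i) (hx : x ∈ G.decision j) (hij : j ≠ i)
    (hyz : y ++ [m] <+: z) (hxz : x ++ [n] <+: z) : y.length ≠ x.length := by
  intro h
  obtain ⟨rfl, -⟩ := prefix_snoc_inj hyz hxz h
  have h1 := (G.mem_decision.1 hy).2.2
  rw [(G.mem_decision.1 hx).2.2] at h1
  exact hij (Option.some.inj h1)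

/-- Each player's commitment on the path to `z` is unique, so the order can be read off from the
depths of any two witnesses. -/
theorem Commits.commitsFirst_iff (h : G.Commits τ i y m (τ z i)) (h' : G.Commits τ j x n (τ z j))
    (hij : j ≠ i) (hy : y ++ [m] <+: z) (hx : x ++ [n] <+: z) :
    G.CommitsFirst τ i z ↔ y.length < x.length := by
  constructor
  · rintro ⟨y', m', hc, hyz, hno⟩
    obtain ⟨rfl, -⟩ := h.unique hc hy hyz
    refine lt_of_le_of_ne (not_lt.1 fun hlt => hno j hij _ ⟨x, n, h',
      snoc_prefix_of_length_lt hx ((List.prefix_append _ _).trans hy) hlt⟩)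
      (length_ne_of_mem_decision h.1.1 h'.1.1 hij hy hx)
  · refine fun hlt => ⟨y, m, h, hy, fun k hk c => ?_⟩
    obtain rfl : k = j := by
      cases i <;> cases j <;> cases k <;> simp_all
    rintro ⟨x', n', hc, hxy⟩
    obtain ⟨rfl, -⟩ := h'.unique hc hx (hxy.trans ((List.prefix_append _ _).trans hy))
    have := hxy.length_le
    simp at this
    omega

theorem FullDisclosure.isPivotal (h : G.FullDisclosure τ) (hy : G.IsPivotal τ i y)
    (hx : x ∈ G.infoSet i (G.info y)) : G.IsPivotal τ i x := by
  rw [mem_infoSet] at hx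
  exact ⟨hx.1, fun b => (hy.2 b).imp fun m hm => (h i x hx.1 y hy.1 hx.2 m b).2 hm⟩

theorem FullDisclosure.represents (h : G.FullDisclosure τ) (hy : G.Represents τ i y m b)
    (hx : x ∈ G.infoSet i (G.info y)) : G.Represents τ i x m b := by
  rw [mem_infoSet] at hx
  exact (h i x hx.1 y hy.1 hx.2 m b).2 hy

/-! ### Commitments along the play of a mechanism -/

section Mechanism

variable {u : Bool → Profile A → ℝ} {σ : Bool → H → M → ℝ}

theorem IsMechanism.exists_commits (hG : G.IsMechanism u τ) (hz : z ∈ G.terminal) (i : Bool) :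
    ∃ y m, G.Commits τ i y m (τ z i) ∧ y ++ [m] <+: z := by
  obtain ⟨y, m, hp, hr, hyz⟩ := hG.2.2 z hz i
  exact ⟨y, m, ⟨hp, hr⟩, (G.mem_terminalAfter.1 hyz).2⟩

/-- Both players commit on the path, and not at the same depth because a node has only one mover. -/
theorem IsMechanism.commitsFirst_iff_not (hG : G.IsMechanism u τ) (hz : z ∈ G.terminal)
    (hij : j ≠ i) : G.CommitsFirst τ j z ↔ ¬ G.CommitsFirst τ i z := by
  obtain ⟨y, m, h, hy⟩ := hG.exists_commits hz i
  obtain ⟨x, n, h', hx⟩ := hG.exists_commits hz j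
  rw [h.commitsFirst_iff h' hij hy hx, h'.commitsFirst_iff h hij.symm hx hy]
  have := length_ne_of_mem_decision h.1.1 h'.1.1 hij hy hx
  omega

/-- Only the continuation after `s` needs positive probability, so this also applies off the
equilibrium path. -/
theorem Commits.mem_committedActions (hσ : G.IsStrategy σ) (h : G.Commits τ i y m b)
    (hyx : y ++ [m] <+: z) {s : List M} (hs : s <+: y)
    (h0 : G.pathProb σ G.chance s (z.drop s.length) ≠ 0) : b ∈ G.committedActions τ σ i := by
  have h1 := G.moveProb_ne_zero_of_pathProb_ne_zero hs hyx h0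
  rw [G.moveProb_of_mem_decision h.1.1] at h1
  exact ⟨y, m, h, lt_of_le_of_ne ((hσ i y h.1.1).1 m h.2.2.1) h1.symm⟩

theorem IsMechanism.committedActions_nonempty (hG : G.IsMechanism u τ) (hσ : G.IsStrategy σ)
    (i : Bool) : (G.committedActions τ σ i).Nonempty := by
  obtain ⟨z, hz, h0⟩ := Finset.exists_ne_zero_of_sum_ne_zero
    ((G.sum_reachProb_terminal hσ).trans_ne one_ne_zero)
  obtain ⟨y, m, h, hy⟩ := hG.exists_commits hz i
  exact ⟨_, h.mem_committedActions hσ hy (List.nil_prefix) (by simpa [reachProb] using h0)⟩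

/-- If the opponent has not committed yet, then all commitments that have positive probability in
the continuation are to actions in `committedActions`. -/
theorem IsMechanism.outcome_mem_committedActions (hG : G.IsMechanism u τ) (hσ : G.IsStrategy σ)
    (hx : x ∈ G.decision i) (hij : j ≠ i) (hno : ∀ c, ¬ G.HasCommitted τ j x c)
    (hz : z ∈ G.terminalAfter (x ++ [m]))
    (h0 : G.pathProb σ G.chance (x ++ [m]) (z.drop (x ++ [m]).length) ≠ 0) :
    τ z j ∈ G.committedActions τ σ j := by
  rw [mem_terminalAfter] at hz
  obtain ⟨y, n, h, hy⟩ := hG.exists_commits hz.1 j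
  refine h.mem_committedActions hσ hy (snoc_prefix_of_length_lt hz.2
    ((List.prefix_append _ _).trans hy) (lt_of_le_of_ne (not_lt.1 fun hlt => ?_)
    (length_ne_of_mem_decision hx h.1.1 hij hz.2 hy))) h0
  exact hno _ ⟨y, n, h, snoc_prefix_of_length_lt hy ((List.prefix_append _ _).trans hz.2) hlt⟩

open Classical in
/-- Distribution of the opponent's action once `i` has chosen `m` at the node `x`. -/
noncomputable def opponentDist (G : ExtensiveGame M H) (τ : List M → Profile A) (σ : Bool → H → M → ℝ)
    (i : Bool) (x : List M) (m : M) (c : A (!i)) : ℝ :=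
  ∑ z ∈ (G.terminalAfter (x ++ [m])).filter (fun z => τ z (!i) = c),
    G.pathProb σ G.chance (x ++ [m]) (z.drop (x ++ [m]).length)

theorem opponentDist_nonneg (hσ : G.IsStrategy σ) (c : A (!i)) :
    0 ≤ G.opponentDist τ σ i x m c := by
  classical exact Finset.sum_nonneg fun _ hz => G.pathProb_drop_nonneg hσ (Finset.mem_filter.1 hz).1

theorem IsMechanism.opponentDist_eq_zero (hG : G.IsMechanism u τ) (hσ : G.IsStrategy σ)
    (hx : x ∈ G.decision i) (hno : ∀ c, ¬ G.HasCommitted τ (!i) x c) (c : A (!i))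
    (hc : c ∉ G.committedActions τ σ (!i)) : G.opponentDist τ σ i x m c = 0 := by
  classical
  refine Finset.sum_eq_zero fun z hz => ?_
  obtain ⟨hz', rfl⟩ := Finset.mem_filter.1 hz
  by_contra h0
  exact hc (hG.outcome_mem_committedActions hσ hx (by simp) hno hz' h0)

-- The point mass depends neither on the node's continuation nor on `m`; this is why the belief `λ⁰`
-- can be independent of the player's own action.
open Classical in
theorem HasCommitted.opponentDist_eq (hσ : G.IsStrategy σ) (hm : m ∈ G.avail x) {c : A (!i)}
    (h : G.HasCommitted τ (!i) x c) (c' : A (!i)) :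
    G.opponentDist τ σ i x m c' = if c = c' then 1 else 0 := by
  have hout : ∀ z ∈ G.terminalAfter (x ++ [m]), τ z (!i) = c := fun z hz =>
    have hz := G.mem_terminalAfter.1 hz
    h.outcome hz.1 ((List.prefix_append _ _).trans hz.2)
  classical
  unfold opponentDist
  split_ifs with hcc
  · rw [Finset.filter_true_of_mem fun z hz => (hout z hz).trans hcc]
    exact G.sum_pathProb_terminalAfter hσ hm
  · rw [Finset.filter_false_of_mem fun z hz h' => hcc ((hout z hz).symm.trans h'),
      Finset.sum_empty]

/-! ### FC-rationalizability of the committed actions -/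

variable [∀ i, Fintype (A i)]

theorem sum_opponentDist (hσ : G.IsStrategy σ) (hm : m ∈ G.avail x) :
    ∑ c, G.opponentDist τ σ i x m c = 1 := by
  classical
  rw [← G.sum_pathProb_terminalAfter hσ hm]
  unfold opponentDist
  convert Finset.sum_fiberwise (G.terminalAfter (x ++ [m])) (fun z => τ z (!i)) _

theorem IsMechanism.continuationPayoff_eq (hG : G.IsMechanism u τ)
    (hm : G.Represents τ i x m b) :
    G.continuationPayoff σ G.chance i (x ++ [m]) =
      ∑ c, u i (Profile.pair i b c) * G.opponentDist τ σ i x m c := by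
  classical
  unfold continuationPayoff opponentDist
  rw [← Finset.sum_fiberwise _ (fun z => τ z (!i))]
  refine Finset.sum_congr rfl fun c _ => ?_
  rw [Finset.mul_sum]
  refine Finset.sum_congr (by congr) fun z hz => ?_
  obtain ⟨hz', rfl⟩ := Finset.mem_filter.1 hz
  rw [hG.1.2 z (G.mem_terminalAfter.1 hz').1, ← hm.2.2.1 z hz', Profile.pair_eta, mul_comm]

/-- The actions to which the players commit with positive probability somewhere in the game are
self-FC-rationalizable. -/
theorem IsMechanism.selfFCRationalizable_committedActions (hG : G.IsMechanism u τ)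
    {ψ : Bool → H → List M → ℝ} (hψ : G.IsBeliefSystem ψ) (hσ : G.IsStrategy σ)
    (hopt : G.SequentiallyRational ψ σ) :
    SelfFCRationalizable u (G.committedActions τ σ) := by
  classical
  rintro i a ⟨y, m, hc, hpos⟩
  -- Several moves may represent `a`; the one selected must be `m`, whose positive probability makes
  -- it optimal.
  have hmv : ∀ b, ∃ n, G.Represents τ i y n b ∧ (b = a → n = m) := by
    intro b
    by_cases hba : b = a
    · subst hba
      exact ⟨m, hc.2, fun _ => rfl⟩
    · obtain ⟨n, hn⟩ := hc.1.2 b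
      exact ⟨n, hn, fun h => absurd h hba⟩
  choose mv hmv hmva using hmv
  have hrep : ∀ x ∈ G.infoSet i (G.info y), ∀ b, G.Represents τ i x (mv b) b :=
    fun x hx b => hG.2.1.represents (hmv b) hx
  have hy := hc.1.1
  let S := (G.infoSet i (G.info y)).filter fun x => ∃ c, G.HasCommitted τ (!i) x c
  let T := (G.infoSet i (G.info y)).filter fun x => ¬ ∃ c, G.HasCommitted τ (!i) x c
  have hS : ∀ x ∈ S, x ∈ G.infoSet i (G.info y) := fun x hx => (Finset.mem_filter.1 hx).1
  have hT : ∀ x ∈ T, x ∈ G.infoSet i (G.info y) := fun x hx => (Finset.mem_filter.1 hx).1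
  have hψ0 : ∀ x ∈ G.infoSet i (G.info y), 0 ≤ ψ i (G.info y) x := (hψ i y hy).1
  have hST : ∀ f : List M → ℝ, ∑ x ∈ G.infoSet i (G.info y), f x = ∑ x ∈ S, f x + ∑ x ∈ T, f x :=
    fun f => (Finset.sum_filter_add_sum_filter_not _ _ _).symm
  -- Joint weight of being at a node of `R` and the opponent ending with `c` after `i` moves to `b`.
  let w : Finset (List M) → A i → A (!i) → ℝ := fun R b c =>
    ∑ x ∈ R, ψ i (G.info y) x * G.opponentDist τ σ i x (mv b) c
  have hw0 : ∀ R, (∀ x ∈ R, x ∈ G.infoSet i (G.info y)) → ∀ b c, 0 ≤ w R b c :=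
    fun R hR b c => Finset.sum_nonneg fun x hx =>
      mul_nonneg (hψ0 x (hR x hx)) (opponentDist_nonneg hσ c)
  have hwsum : ∀ R, (∀ x ∈ R, x ∈ G.infoSet i (G.info y)) → ∀ b,
      ∑ c, w R b c = ∑ x ∈ R, ψ i (G.info y) x := by
    intro R hR b
    rw [Finset.sum_comm]
    refine Finset.sum_congr rfl fun x hx => ?_
    rw [← Finset.mul_sum, sum_opponentDist hσ (hrep x (hR x hx) b).2.1, mul_one]
  have hne := hG.committedActions_nonempty hσ (!i)
  -- On `S` the opponent may have committed to a suboptimal action, so `lam0` has no support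
  -- restriction. It is built from `a`, but `hwS` below shows that any `b` gives the same weights.
  obtain ⟨lam0, hlam0, -, hlam0'⟩ := exists_mem_stdSimplex_mul_eq Set.univ
    (hne.mono (Set.subset_univ _)) (w S a) (hw0 S hS a) (by simp)
  have h1 : ∀ b, ∃ p ∈ stdSimplex ℝ (A (!i)), (∀ c, c ∉ G.committedActions τ σ (!i) → p c = 0) ∧
      ∀ c, (∑ c', w T b c') * p c = w T b c := fun b =>
    exists_mem_stdSimplex_mul_eq _ hne (w T b) (hw0 T hT b) fun c hc' =>
      Finset.sum_eq_zero fun x hx => by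
        obtain ⟨hx, hno⟩ := Finset.mem_filter.1 hx
        rw [hG.opponentDist_eq_zero hσ (G.mem_infoSet.1 hx).1 (not_exists.1 hno) c hc', mul_zero]
  choose lam1 hlam1 hlam1S hlam1' using h1
  rw [hwsum S hS] at hlam0'
  simp only [hwsum T hT] at hlam1'
  have htot : ∑ x ∈ S, ψ i (G.info y) x + ∑ x ∈ T, ψ i (G.info y) x = 1 := by
    rw [← hST]
    exact (hψ i y hy).2
  have hμ0 : 0 ≤ ∑ x ∈ S, ψ i (G.info y) x := Finset.sum_nonneg fun x hx => hψ0 x (hS x hx)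
  have hμ1 : 0 ≤ ∑ x ∈ T, ψ i (G.info y) x := Finset.sum_nonneg fun x hx => hψ0 x (hT x hx)
  have hwS : ∀ b, w S b = w S a := by
    intro b
    funext c
    refine Finset.sum_congr rfl fun x hx => ?_
    obtain ⟨c', hc'⟩ := (Finset.mem_filter.1 hx).2
    rw [hc'.opponentDist_eq hσ (hrep x (hS x hx) b).2.1,
      hc'.opponentDist_eq hσ (hrep x (hS x hx) a).2.1]
  -- With `μ` the belief in `S`, counterfactual utility is exactly the interim payoff, so optimality
  -- of `m` transfers.
  have hutil : ∀ b, counterfactualUtility u i b (fun z c => (∑ x ∈ S, ψ i (G.info y) x) * lam0 c +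
      (1 - ∑ x ∈ S, ψ i (G.info y) x) * lam1 z c) =
        G.interimPayoff ψ σ i (G.info y) (mv b) := by
    intro b
    have hT' : 1 - ∑ x ∈ S, ψ i (G.info y) x = ∑ x ∈ T, ψ i (G.info y) x := by linarith
    simp only [counterfactualUtility, interimPayoff, hT', hlam0', hlam1', ← hwS b]
    have hcont : ∀ x ∈ G.infoSet i (G.info y),
        ψ i (G.info y) x * G.continuationPayoff σ G.chance i (x ++ [mv b]) =
          ∑ c, ψ i (G.info y) x * (u i (Profile.pair i b c) * G.opponentDist τ σ i x (mv b) c) :=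
      fun x hx => by rw [hG.continuationPayoff_eq (hrep x hx b), Finset.mul_sum]
    rw [Finset.sum_congr rfl hcont, Finset.sum_comm]
    refine Finset.sum_congr rfl fun c _ => ?_
    rw [hST, mul_add, Finset.mul_sum, Finset.mul_sum]
    congr 1 <;> exact Finset.sum_congr rfl fun x _ => by ring
  refine ⟨lam0, hlam0, lam1, fun b => ⟨hlam1 b, hlam1S b⟩, _, ⟨hμ0, by linarith⟩, fun b => ?_⟩
  rw [hutil, hutil, hmva a rfl]
  exact hopt i y hy m hc.2.2.1 (mv b) (hmv b).2.1 hpos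

/-! ### Incentive constraints implied by the equilibrium -/

/-- Sequential rationality, weighted by the probability of reaching the information set. -/
theorem IsSequentialEquilibrium.sum_reachProb_mul_nonneg {ψ : Bool → H → List M → ℝ}
    (hE : G.IsSequentialEquilibrium ψ σ) (hy : y ∈ G.decision i) (hm : m ∈ G.avail y)
    (hn : n ∈ G.avail y) :
    0 ≤ ∑ x ∈ G.infoSet i (G.info y), G.reachProb σ G.chance x * σ i (G.info y) m *
      (G.continuationPayoff σ G.chance i (x ++ [m]) -
        G.continuationPayoff σ G.chance i (x ++ [n])) := by
  obtain ⟨-, hσ, hcons, hopt⟩ := hE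
  have hm0 := (hσ i y hy).1 m hm
  have hR : 0 ≤ ∑ x ∈ G.infoSet i (G.info y), G.reachProb σ G.chance x :=
    Finset.sum_nonneg fun x hx =>
      G.reachProb_nonneg hσ (G.mem_decision.1 (G.mem_infoSet.1 hx).1).1
  have hsum : ∑ x ∈ G.infoSet i (G.info y), G.reachProb σ G.chance x * σ i (G.info y) m *
      (G.continuationPayoff σ G.chance i (x ++ [m]) -
        G.continuationPayoff σ G.chance i (x ++ [n])) =
      (∑ x ∈ G.infoSet i (G.info y), G.reachProb σ G.chance x) * (σ i (G.info y) m *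
        (G.interimPayoff ψ σ i (G.info y) m - G.interimPayoff ψ σ i (G.info y) n)) := by
    unfold interimPayoff
    rw [← Finset.sum_sub_distrib, Finset.mul_sum, Finset.mul_sum]
    refine Finset.sum_congr rfl fun x hx => ?_
    obtain ⟨hx, hxy⟩ := G.mem_infoSet.1 hx
    have := hcons.belief_mul_sum hx
    rw [hxy] at this
    rw [← this]
    ring
  rw [hsum]
  rcases hm0.eq_or_lt with h0 | hpos
  · rw [← h0, zero_mul, mul_zero]
  · exact mul_nonneg hR (mul_nonneg hm0 (sub_nonneg.2 (hopt i y hy m hm n hn hpos)))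

open Classical in
/-- The gain from committing to `b` rather than deviating to `b'` when the opponent has not
committed yet is at most the gain when the opponent reacts with a payoff `v` to the deviation, if
`v` is a lower bound for the payoffs from `b'` against `committedActions`. -/
theorem IsMechanism.reachProb_mul_le (hG : G.IsMechanism u τ) (hσ : G.IsStrategy σ)
    (hc : G.Commits τ i x m b) {b' : A i} (hn : G.Represents τ i x n b') {v : ℝ}
    (hv : ∀ c ∈ G.committedActions τ σ (!i), v ≤ u i (Profile.pair i b' c)) :
    G.reachProb σ G.chance x * σ i (G.info x) m *
        (G.continuationPayoff σ G.chance i (x ++ [m]) -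
          G.continuationPayoff σ G.chance i (x ++ [n])) ≤
      ∑ z ∈ G.terminalAfter (x ++ [m]), G.reachProb σ G.chance z *
        (u i (τ z) - if G.CommitsFirst τ i z then v else u i (Profile.pair i b' (τ z (!i)))) := by
  have hx := hc.1.1
  have hm := hc.2.2.1
  have hfactor : ∀ f : List M → ℝ,
      ∑ z ∈ G.terminalAfter (x ++ [m]), G.reachProb σ G.chance z * f z =
        G.reachProb σ G.chance x * σ i (G.info x) m * ∑ z ∈ G.terminalAfter (x ++ [m]),
          G.pathProb σ G.chance (x ++ [m]) (z.drop (x ++ [m]).length) * f z := by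
    intro f
    rw [Finset.mul_sum]
    refine Finset.sum_congr rfl fun z hz => ?_
    rw [G.reachProb_eq_mul (G.mem_terminalAfter.1 hz).2, G.moveProb_of_mem_decision hx]
    ring
  rw [hfactor]
  refine mul_le_mul_of_nonneg_left ?_
    (mul_nonneg (G.reachProb_nonneg hσ (G.mem_decision.1 hx).1) ((hσ i x hx).1 m hm))
  simp only [mul_sub, Finset.sum_sub_distrib]
  refine sub_le_sub (le_of_eq ?_) ?_
  · exact Finset.sum_congr rfl fun z hz => by rw [hG.1.2 z (G.mem_terminalAfter.1 hz).1]
  · rw [hG.continuationPayoff_eq hn]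
    -- Whether `i` commits first is already decided at `x`, so the `if` is constant over the
    -- terminal nodes after `x ++ [m]`.
    by_cases hcom : ∃ c, G.HasCommitted τ (!i) x c
    · obtain ⟨c, hcom⟩ := hcom
      have hterm : ∀ z ∈ G.terminalAfter (x ++ [m]),
          (if G.CommitsFirst τ i z then v else u i (Profile.pair i b' (τ z (!i)))) =
            u i (Profile.pair i b' c) := by
        intro z hz
        obtain ⟨hz, hxz⟩ := G.mem_terminalAfter.1 hz
        rw [if_neg, hcom.outcome hz ((List.prefix_append _ _).trans hxz)]
        rintro ⟨y, m', hc', hyz, hno⟩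
        obtain ⟨rfl, -⟩ := hc.unique hc' hxz hyz
        exact hno _ (by simp) c hcom
      rw [Finset.sum_congr rfl fun z hz => by rw [hterm z hz], ← Finset.sum_mul,
        G.sum_pathProb_terminalAfter hσ hm]
      simp [hcom.opponentDist_eq hσ hn.2.1]
    · rw [not_exists] at hcom
      have hterm : ∀ z ∈ G.terminalAfter (x ++ [m]),
          (if G.CommitsFirst τ i z then v else u i (Profile.pair i b' (τ z (!i)))) = v := by
        intro z hz
        refine if_pos ⟨x, m, hc.2.2.2.1 z hz ▸ hc, (G.mem_terminalAfter.1 hz).2, fun j hj => ?_⟩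
        obtain rfl : j = !i := by cases i <;> cases j <;> simp_all
        exact hcom
      rw [Finset.sum_congr rfl fun z hz => by rw [hterm z hz], ← Finset.sum_mul,
        G.sum_pathProb_terminalAfter hσ hm, ← sum_opponentDist (τ := τ) hσ hn.2.1, Finset.sum_mul]
      refine Finset.sum_le_sum fun c _ => ?_
      by_cases hmem : c ∈ G.committedActions τ σ (!i)
      · rw [mul_comm]
        exact mul_le_mul_of_nonneg_right (hv c hmem) (opponentDist_nonneg hσ c)
      · rw [hG.opponentDist_eq_zero hσ hx hcom c hmem, zero_mul, mul_zero]

-- Each terminal node with action `b` follows a unique commitment to `b`, so the sum splits over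
-- commitments. Regrouped by information set and move, these are bounded below by the equilibrium's
-- optimality conditions.
open Classical in
theorem IsMechanism.sum_terminal_nonneg (hG : G.IsMechanism u τ) {ψ : Bool → H → List M → ℝ}
    (hE : G.IsSequentialEquilibrium ψ σ) (b b' : A i) {v : ℝ}
    (hv : ∀ c ∈ G.committedActions τ σ (!i), v ≤ u i (Profile.pair i b' c)) :
    0 ≤ ∑ z ∈ G.terminal.filter (fun z => τ z i = b), G.reachProb σ G.chance z *
      (u i (τ z) - if G.CommitsFirst τ i z then v else u i (Profile.pair i b' (τ z (!i)))) := by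
  have hσ := hE.2.1
  let P : Finset (Σ _ : List M, M) := ((G.decision i).sigma fun x =>
    (G.avail_finite x).toFinset).filter fun p => G.Commits τ i p.1 p.2 b
  have hP : ∀ p, p ∈ P ↔ G.Commits τ i p.1 p.2 b := by
    intro p
    simp only [P, Finset.mem_filter, Finset.mem_sigma, Set.Finite.mem_toFinset,
      and_iff_right_iff_imp]
    exact fun h => ⟨h.1.1, h.2.2.1⟩
  have hunion : G.terminal.filter (fun z => τ z i = b) =
      P.biUnion fun p => G.terminalAfter (p.1 ++ [p.2]) := by
    ext z
    simp only [Finset.mem_filter, Finset.mem_biUnion, hP, mem_terminalAfter]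
    constructor
    · rintro ⟨hz, rfl⟩
      obtain ⟨x, m, hc, hxz⟩ := hG.exists_commits hz i
      exact ⟨⟨x, m⟩, hc, hz, hxz⟩
    · rintro ⟨p, hc, hz, hpz⟩
      exact ⟨hz, hc.outcome hz hpz⟩
  rw [hunion, Finset.sum_biUnion]
  swap
  · intro p hp q hq hpq
    refine Finset.disjoint_left.2 fun z hz hz' => hpq ?_
    obtain ⟨h1, h2⟩ := ((hP p).1 hp).unique ((hP q).1 hq) (G.mem_terminalAfter.1 hz).2
      (G.mem_terminalAfter.1 hz').2
    exact Sigma.ext h1 (heq_of_eq h2)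
  -- The deviating move must be the same throughout an information set; full disclosure lets one
  -- move represent `b'` at all its nodes. A label without pivotal nodes gets an arbitrary move.
  have hdev : ∀ h : H, ∃ n : M, ∀ x, G.IsPivotal τ i x → G.info x = h →
      G.Represents τ i x n b' := by
    intro h
    by_cases hex : ∃ x, G.IsPivotal τ i x ∧ G.info x = h
    · obtain ⟨x, hx, rfl⟩ := hex
      obtain ⟨n, hn⟩ := hx.2 b'
      exact ⟨n, fun x' hx' hxx => hG.2.1.represents hn (G.mem_infoSet.2 ⟨hx'.1, hxx⟩)⟩
    · obtain ⟨-, -, m, -⟩ := hG.committedActions_nonempty hσ i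
      exact ⟨m, fun x hx hxh => absurd ⟨x, hx, hxh⟩ hex⟩
  choose dev hdev using hdev
  refine le_trans ?_ (Finset.sum_le_sum fun p hp => hG.reachProb_mul_le hσ ((hP p).1 hp)
    (hdev _ p.1 ((hP p).1 hp).1 rfl) hv)
  -- By full disclosure each fiber is a whole information set paired with one move, as
  -- `sum_reachProb_mul_nonneg` requires.
  rw [← Finset.sum_fiberwise_of_maps_to (t := P.image fun p => (G.info p.1, p.2))
    (g := fun p => (G.info p.1, p.2)) fun p hp => Finset.mem_image_of_mem _ hp]
  refine Finset.sum_nonneg fun k hk => ?_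
  obtain ⟨q, hq, rfl⟩ := Finset.mem_image.1 hk
  have hq' := (hP q).1 hq
  refine le_of_le_of_eq (hE.sum_reachProb_mul_nonneg hq'.1.1 hq'.2.2.1
    (hdev _ q.1 hq'.1 rfl).2.1) ?_
  refine Finset.sum_nbij' (fun x => ⟨x, q.2⟩) (fun p => p.1) ?_ ?_ ?_ ?_ ?_
  · intro x hx
    refine Finset.mem_filter.2 ⟨(hP _).2 ⟨hG.2.1.isPivotal hq'.1 hx,
      hG.2.1.represents hq'.2 hx⟩, ?_⟩
    exact Prod.ext (G.mem_infoSet.1 hx).2 rfl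
  · intro p hp
    obtain ⟨hp, hpq⟩ := Finset.mem_filter.1 hp
    exact G.mem_infoSet.2 ⟨((hP p).1 hp).1.1, congrArg Prod.fst hpq⟩
  · exact fun _ _ => rfl
  · intro p hp
    have := congrArg Prod.snd (Finset.mem_filter.1 hp).2
    exact Sigma.ext rfl (heq_of_eq this.symm)
  · intro x hx
    simp only [(G.mem_infoSet.1 hx).2]

end Mechanism

end Commitment

end ExtensiveGame

/-! ### The mediated mechanism -/

theorem exists_isWorstPunishment {A : Bool → Type u} [∀ i, Fintype (A i)]
    (u : Bool → Profile A → ℝ) {B : ∀ j, Set (A j)} (hB : ∀ j, (B j).Nonempty) :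
    ∃ pun, IsWorstPunishment u B pun := by
  have h : ∀ i (x : A i), ∃ y ∈ B (!i), ∀ y' ∈ B (!i),
      u i (Profile.pair i x y) ≤ u i (Profile.pair i x y') := fun i x =>
    Set.exists_min_image (B (!i)) (fun y => u i (Profile.pair i x y)) (B (!i)).toFinite (hB _)
  choose pun hpun using h
  exact ⟨pun, hpun⟩

theorem sum_bool_eq (i : Bool) (f : Bool → ℝ) : ∑ j, f j = f i + f (!i) := by
  cases i <;> simp [add_comm]

/-- Sufficient condition for incentive compatibility of a mediated mechanism. -/
theorem incentiveCompatible_of_sum_nonneg {A : Bool → Type u} [∀ i, Fintype (A i)]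
    [∀ i, DecidableEq (A i)] {u : Bool → Profile A → ℝ} {α : Profile A → ℝ}
    {θ : Profile A → Bool → ℝ} {B : ∀ j, Set (A j)} {pun : ∀ i, A i → A (!i)}
    (hpun : IsWorstPunishment u (effectiveThreats α B) pun)
    (h : ∀ i (x x' : A i), 0 ≤ ∑ a with a i = x,
      (α a * θ a i * (u i a - u i (Profile.pair i x' (pun i x'))) +
        α a * θ a (!i) * (u i a - u i (Profile.pair i x' (a (!i)))))) :
    IncentiveCompatible u α θ B := by
  refine ⟨pun, hpun, fun i s => ?_⟩
  rw [← sub_nonneg]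
  unfold mediatedPayoff
  rw [← Finset.sum_sub_distrib, ← Finset.sum_fiberwise _ (fun a => a i)]
  refine Finset.sum_nonneg fun x _ => ?_
  simp only [sum_bool_eq i, mediatedPlay_id, mediatedPlay_update_self,
    mediatedPlay_update_opponent]
  -- Obedience at `x` changes nothing and triggers no punishment, so `h` is needed only for genuine
  -- deviations.
  by_cases hx : s x = x
  · refine le_of_eq (Finset.sum_eq_zero fun a ha => ?_).symm
    obtain rfl := (Finset.mem_filter.1 ha).2
    simp [hx]
  · refine le_of_le_of_eq (h i x (s x)) (Finset.sum_congr rfl fun a ha => ?_)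
    obtain rfl := (Finset.mem_filter.1 ha).2
    rw [if_neg hx]
    ring

theorem mainTheorem6 {A : Bool → Type u} [∀ i, Fintype (A i)]
    (u : Bool → Profile A → ℝ) (α : Profile A → ℝ)
    (hα : SequentiallyImplementable.{u, v} u α) :
    IsICE u (fcRationalizable u) α := by
  classical
  obtain ⟨hαs, M, H, G, τ, ψ, σ, hG, hE, hind⟩ := hα
  have hσ := hE.2.1
  have hsub : ∀ j, G.committedActions τ σ j ⊆ fcRationalizable u j := fun j =>
    (isGreatest_fcRationalizable u).2
      (hG.selfFCRationalizable_committedActions hE.1 hσ hE.2.2.2) j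
  have hthreat : ∀ j, G.committedActions τ σ j ⊆ effectiveThreats α (fcRationalizable u) j :=
    fun j => (hsub j).trans Set.subset_union_left
  obtain ⟨pun, hpun⟩ := exists_isWorstPunishment u (B := effectiveThreats α (fcRationalizable u))
    fun j => (hG.committedActions_nonempty hσ j).mono (hthreat j)
  have hr0 : ∀ z ∈ G.terminal, 0 ≤ G.reachProb σ G.chance z := fun z hz =>
    G.reachProb_nonneg hσ (G.mem_terminal.1 hz).1
  have hαsum : ∀ a, α a = ∑ z ∈ G.terminal with τ z = a, G.reachProb σ G.chance z := by
    intro a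
    rw [hind, ExtensiveGame.inducedDist]
  -- Probability that the outcome is `a` and `j` commits first; dividing by `α a` gives `θ a j`,
  -- which is arbitrary where `α a = 0`.
  let w : Profile A → Bool → ℝ := fun a j =>
    ∑ z ∈ G.terminal with τ z = a, if G.CommitsFirst τ j z then G.reachProb σ G.chance z else 0
  have hw0 : ∀ a j, 0 ≤ w a j := fun a j => Finset.sum_nonneg fun z hz => by
    split_ifs
    exacts [hr0 z (Finset.mem_filter.1 hz).1, le_rfl]
  have hwsum : ∀ a i, w a i + w a (!i) = α a := by
    intro a i
    rw [hαsum, ← Finset.sum_add_distrib]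
    refine Finset.sum_congr rfl fun z hz => ?_
    have := hG.commitsFirst_iff_not (Finset.mem_filter.1 hz).1 (i := i) (j := !i) (by simp)
    by_cases hf : G.CommitsFirst τ i z <;> simp [this, hf]
  have hθ : ∀ a, ∃ p ∈ stdSimplex ℝ Bool, ∀ j, α a * p j = w a j := by
    intro a
    obtain ⟨p, hp, -, hpw⟩ := exists_mem_stdSimplex_mul_eq Set.univ Set.univ_nonempty (w a)
      (hw0 a) (by simp)
    rw [sum_bool_eq false, hwsum] at hpw
    exact ⟨p, hp, hpw⟩
  choose θ hθ hθw using hθ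
  refine ⟨hαs, θ, hθ, incentiveCompatible_of_sum_nonneg hpun fun i x x' => ?_⟩
  -- Here `v` is the payoff from the worst punishment, a lower bound because the effective threats
  -- contain `committedActions`.
  refine le_of_le_of_eq (hG.sum_terminal_nonneg hE x x' fun c hc =>
    (hpun i x').2 c (hthreat _ hc)) ?_
  rw [← Finset.sum_fiberwise_of_maps_to (t := Finset.univ.filter fun a : Profile A => a i = x)
    (g := τ) (by simp)]
  refine Finset.sum_congr rfl fun a ha => ?_
  obtain rfl := (Finset.mem_filter.1 ha).2
  rw [hθw, hθw, Finset.sum_mul, Finset.sum_mul, ← Finset.sum_add_distrib, Finset.filter_filter]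
  refine Finset.sum_congr (Finset.filter_congr fun z _ => ⟨fun h => h.2, ?_⟩) fun z hz => ?_
  · rintro rfl
    exact ⟨rfl, rfl⟩
  · obtain ⟨hz', rfl⟩ := Finset.mem_filter.1 hz
    have := hG.commitsFirst_iff_not hz' (i := i) (j := !i) (by simp)
    by_cases hf : G.CommitsFirst τ i z <;> simp [this, hf]
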